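/- In the best choice problem with an unknown number of items, $n$ items ranked from best to worst arrive at independent, uniformly distributed random times in $[0,1]$. The player, who does not know $n$, observes the arrivals in chronological order with their arrival times and their ranks relative to the items seen so far. An arrival is a record if it is better than all earlier arrivals. A stopping strategy $\tau$ selects, on the basis of what has been observed so far, at most one record at the time of its arrival; it wins if the selected item is the best of the $n$ items, and $W(\tau,n)$ denotes its winning probability. The cutoff strategy with cutoffs $(a_k)_{k\ge 1}$, $0\le a_k\le 1$, stops at the first record whose arrival time $t$ satisfies $t\ge a_k$, where $k$ is the number of items that have arrived up to and including time $t$. The $1/e$-strategy $\tau_{1/e}$ is the cutoff strategy with $a_k=1/e$ for all $k$, that is, it stops at the first record arriving at or after time $1/e$. For every finite set $Z$ of positive integers there exists a stopping strategy $\tau$, which can be taken to be a cutoff strategy, that strongly dominates the $1/e$-strategy on $Z$, i.e. $W(\tau,n)>W(\tau_{1/e},n)$ for every $n\in Z$. -/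

import Mathlib

noncomputable section

namespace BestChoice

/-- The order in which the `n` items arrive. Items are labelled by quality, item `0` being the
overall best one, and `T i` is the arrival time of item `i`; `arrivalOrder T k` is the item that
arrives in position `k` (positions are counted from `0`). Ties have probability zero. -/
def arrivalOrder {n : ℕ} (T : Fin n → ℝ) : Equiv.Perm (Fin n) :=
  Tuple.sort T

/-- The time of the arrival in position `k`: the order statistics of the sample `T`. -/
def arrivalTime {n : ℕ} (T : Fin n → ℝ) (k : Fin n) : ℝ :=
  T (arrivalOrder T k)

/-- The relative rank, among the arrivals so far, of the arrival in position `k`: one plus the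
number of earlier arrivals that are better. The arrival is a record if this is `1`. -/
def relRank {n : ℕ} (T : Fin n → ℝ) (k : Fin n) : ℕ :=
  1 + (Finset.univ.filter fun j : Fin n => j < k ∧ arrivalOrder T j < arrivalOrder T k).card

/-- A (pure) stopping strategy, which does not know the number of items: at a record it says,
from the times and the relative ranks of the arrivals seen so far (`k + 1` of them, the last one
being the record in question), whether to stop there. -/
structure Strategy where
  /-- whether to stop at the last of `k + 1` observed arrivals, if it is a record -/
  accept : (k : ℕ) → (Fin (k + 1) → ℝ) → (Fin (k + 1) → ℕ) → Prop
  measurableSet_accept : ∀ (k : ℕ) (r : Fin (k + 1) → ℕ), MeasurableSet {t | accept k t r}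

/-- The arrival in position `k` is a record, and the strategy is willing to stop at it. -/
def Strategy.Acceptable (τ : Strategy) {n : ℕ} (T : Fin n → ℝ) (k : Fin n) : Prop :=
  relRank T k = 1 ∧
    τ.accept k (fun j => arrivalTime T (Fin.castLE k.isLt j))
      (fun j => relRank T (Fin.castLE k.isLt j))

/-- The strategy stops at the arrival in position `k`, the first acceptable one. -/
def Strategy.StopsAt (τ : Strategy) {n : ℕ} (T : Fin n → ℝ) (k : Fin n) : Prop :=
  τ.Acceptable T k ∧ ∀ j < k, ¬ τ.Acceptable T j

/-- The strategy wins: it stops at a record after which no further record arrives. -/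
def Strategy.Wins (τ : Strategy) {n : ℕ} (T : Fin n → ℝ) : Prop :=
  ∃ k : Fin n, τ.StopsAt T k ∧ ∀ j : Fin n, k < j → 1 < relRank T j

/-- The winning probability `W(τ, n)`: the arrival times of the `n` items are independent and
uniformly distributed on `[0, 1]`. -/
def Strategy.winProb (τ : Strategy) (n : ℕ) : ℝ :=
  (MeasureTheory.Measure.pi fun _ : Fin n =>
    (MeasureTheory.volume : MeasureTheory.Measure ℝ).restrict (Set.Icc 0 1)).real
      {T | τ.Wins T}

/-- `τ'` strongly dominates `τ` on the set `Z`. -/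
def StronglyDominatesOn (τ' τ : Strategy) (Z : Set ℕ) : Prop :=
  ∀ n ∈ Z, τ.winProb n < τ'.winProb n

/-- The cutoff strategy with cutoffs `a 1, a 2, …`: it stops at the first record such that the
arrival time `t` and the index `k` (the number of arrivals so far) satisfy `t ≥ a k`. -/
def cutoffStrategy (a : ℕ → ℝ) : Strategy where
  accept k t _ := a (k + 1) ≤ t (Fin.last k)
  measurableSet_accept k _ :=
    measurableSet_le measurable_const (measurable_pi_apply (Fin.last k))

/-- The `x`-strategy, which stops at the first record arriving at or after time `x`. -/
def xStrategy (x : ℝ) : Strategy :=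
  cutoffStrategy fun _ => x

end BestChoice

end

/-! Lower the cutoffs slightly below `x = 1/e`, to `a k = x - δ k`, with `δ` growing so fast that
for each `n = m + 1` in `Z` only the last cutoff matters. A new win occurs when the best item
arrives in `[a (m+1), a m)` and all others before `a (m+1)`: the `x`-strategy then never stops. This
has probability `(δ (m+1) - δ m) * a (m+1) ^ m`. An old win is lost only if some item falls in `[a
m, x)`, with probability at most `(m+1) * δ m`. If `δ (m+1) = M * δ m` with `M` large, the gain
exceeds the loss. Finiteness of `Z` allows one `M` for all `n`. Optimality of `1/e` plays no role.
-/

theorem BestChoice.cutoffStrategy_acceptable {n : ℕ} (a : ℕ → ℝ) (T : Fin n → ℝ) (k : Fin n) :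
    (cutoffStrategy a).Acceptable T k ↔ relRank T k = 1 ∧ a (k + 1) ≤ arrivalTime T k :=
  Iff.rfl

/-- When the best item arrives strictly last, the cutoff strategy wins as soon as the last cutoff
lies between its arrival time and all the earlier ones, and the cutoffs are antitone. -/
theorem BestChoice.cutoffStrategy_wins_of_best_last {m : ℕ} {a : ℕ → ℝ} (ha : Antitone a)
    {T : Fin (m + 1) → ℝ} (h0 : a (m + 1) ≤ T 0) (h : ∀ i ≠ 0, T i < a (m + 1)) :
    (cutoffStrategy a).Wins T := by
  have hmono : Monotone (T ∘ Tuple.sort T) := Tuple.monotone_sort T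
  have hlast : arrivalOrder T (Fin.last m) = 0 := by
    by_contra hne
    obtain ⟨j, hj⟩ := (arrivalOrder T).surjective 0
    have h1 : T (arrivalOrder T j) ≤ T (arrivalOrder T (Fin.last m)) := hmono (Fin.le_last j)
    have h2 := h _ hne
    rw [hj] at h1
    linarith
  refine ⟨Fin.last m, ⟨?_, fun j hj hacc => ?_⟩, fun j hj => absurd (Fin.le_last j) hj.not_ge⟩
  · refine (cutoffStrategy_acceptable a T _).2 ⟨?_, ?_⟩
    · simp [relRank, hlast]
    · simpa [arrivalTime, hlast] using h0
  · have hj0 : arrivalOrder T j ≠ 0 := fun h' =>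
      hj.ne ((arrivalOrder T).injective (h'.trans hlast.symm))
    have h1 := ((cutoffStrategy_acceptable a T j).1 hacc).2
    have h2 : a (m + 1) ≤ a (j + 1) := ha (by have := j.isLt; omega)
    exact absurd (h _ hj0) (not_lt.2 (h2.trans h1))

/-- The `x`-strategy does not win if all items arrive before time `x`. -/
theorem BestChoice.not_xStrategy_wins_of_lt {n : ℕ} {x : ℝ} {T : Fin n → ℝ} (h : ∀ i, T i < x) :
    ¬ (xStrategy x).Wins T := by
  rintro ⟨k, ⟨hk, -⟩, -⟩
  exact absurd (h _) (not_lt.2 ((cutoffStrategy_acceptable _ T k).1 hk).2)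

/-- Lowering the cutoffs does not destroy a win of the `x`-strategy, unless some item arrives in
the time window from the last but one cutoff to `x`. -/
theorem BestChoice.cutoffStrategy_wins_of_xStrategy_wins {m : ℕ} {a : ℕ → ℝ} (ha : Antitone a)
    {x : ℝ} (hx : ∀ k, a k ≤ x) {T : Fin (m + 1) → ℝ} (hT : ∀ i, T i ∉ Set.Ico (a m) x)
    (h : (xStrategy x).Wins T) : (cutoffStrategy a).Wins T := by
  obtain ⟨k, ⟨hk, hmin⟩, hlast⟩ := h
  have hk' := (cutoffStrategy_acceptable _ T k).1 hk
  refine ⟨k, ⟨(cutoffStrategy_acceptable a T k).2 ⟨hk'.1, (hx _).trans hk'.2⟩,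
    fun j hj hacc => hmin j hj ?_⟩, hlast⟩
  have hj' := (cutoffStrategy_acceptable a T j).1 hacc
  refine (cutoffStrategy_acceptable _ T j).2 ⟨hj'.1, ?_⟩
  by_contra hlt
  -- A premature stop precedes the winning arrival, so it is not the last of the `m + 1` arrivals
  -- and never uses the lowest cutoff `a (m + 1)`.
  have hjm : (j : ℕ) + 1 ≤ m := by
    have := k.isLt
    have : (j : ℕ) < k := hj
    omega
  exact hT _ ⟨(ha hjm).trans hj'.2, not_le.1 hlt⟩

open MeasureTheory in
/-- Comparison of a cutoff strategy whose antitone cutoffs lie below `x` with the `x`-strategy. -/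
theorem BestChoice.xStrategy_winProb_add_le {a : ℕ → ℝ} (ha : Antitone a) (h0 : ∀ k, 0 ≤ a k)
    {x : ℝ} (hx : ∀ k, a k ≤ x) (hx1 : x ≤ 1) (m : ℕ) :
    (xStrategy x).winProb (m + 1) + (a m - a (m + 1)) * a (m + 1) ^ m ≤
      (cutoffStrategy a).winProb (m + 1) + (m + 1) * (x - a m) := by
  set ν : Measure ℝ := volume.restrict (Set.Icc 0 1) with hν
  have hIco : ∀ b c : ℝ, 0 ≤ b → b ≤ c → c ≤ 1 → ν.real (Set.Ico b c) = c - b := by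
    intro b c hb hbc hc
    rw [hν, measureReal_restrict_apply measurableSet_Ico, Set.inter_eq_left.2,
      Real.volume_real_Ico_of_le hbc]
    exact fun t ht => ⟨hb.trans ht.1, ht.2.le.trans hc⟩
  have : IsProbabilityMeasure ν := ⟨by simp [hν]⟩
  set μ : Measure (Fin (m + 1) → ℝ) := Measure.pi fun _ => ν with hμ
  let G : Set (Fin (m + 1) → ℝ) := Set.univ.pi
    (Fin.cons (Set.Ico (a (m + 1)) (a m)) fun _ => Set.Ico 0 (a (m + 1)))
  let B : Set (Fin (m + 1) → ℝ) := ⋃ i, (fun T => T i) ⁻¹' Set.Ico (a m) x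
  have hGmeas : MeasurableSet G := by
    refine MeasurableSet.univ_pi fun i => ?_
    refine Fin.cases ?_ (fun i => ?_) i <;> simp [measurableSet_Ico]
  have hG : μ.real G = (a m - a (m + 1)) * a (m + 1) ^ m := by
    rw [hμ, Measure.real, Measure.pi_pi, ENNReal.toReal_prod, Fin.prod_univ_succ]
    simp only [Fin.cons_zero, Fin.cons_succ, ← measureReal_def]
    rw [hIco _ _ (h0 _) (ha m.le_succ) ((hx _).trans hx1),
      hIco _ _ le_rfl (h0 _) ((hx _).trans hx1)]
    simp
  have hB : μ.real B ≤ (m + 1) * (x - a m) := by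
    refine (measureReal_iUnion_fintype_le _).trans ?_
    have : ∀ i : Fin (m + 1), μ.real ((fun T => T i) ⁻¹' Set.Ico (a m) x) = x - a m := by
      intro i
      rw [hμ, Measure.real, (measurePreserving_eval (fun _ : Fin (m + 1) => ν) i).measure_preimage
        measurableSet_Ico.nullMeasurableSet, ← measureReal_def, hIco _ _ (h0 _) (hx _) hx1]
    rw [Finset.sum_congr rfl fun i _ => this i, Finset.sum_const, Finset.card_univ,
      Fintype.card_fin, nsmul_eq_mul, Nat.cast_succ]
  have hGmem : ∀ T ∈ G, (a (m + 1) ≤ T 0 ∧ T 0 < a m) ∧ ∀ i ≠ 0, T i < a (m + 1) := by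
    intro T hT
    refine ⟨by simpa using hT 0 (Set.mem_univ _), fun i => ?_⟩
    refine Fin.cases (fun h => absurd rfl h) (fun i _ => ?_) i
    have := hT i.succ (Set.mem_univ _)
    simp only [Fin.cons_succ] at this
    exact this.2
  have hsub : G ∪ ({T | (xStrategy x).Wins T} \ B) ⊆ {T | (cutoffStrategy a).Wins T} := by
    rintro T (hT | ⟨hT, hTB⟩)
    · exact cutoffStrategy_wins_of_best_last ha (hGmem T hT).1.1 (hGmem T hT).2
    · exact cutoffStrategy_wins_of_xStrategy_wins ha hx
        (fun i hi => hTB (Set.mem_iUnion.2 ⟨i, hi⟩)) hT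
  have hdisj : Disjoint G ({T | (xStrategy x).Wins T} \ B) := by
    refine Set.disjoint_left.2 fun T hT hT' => not_xStrategy_wins_of_lt (fun i => ?_) hT'.1
    by_cases hi : i = 0
    · exact hi ▸ (hGmem T hT).1.2.trans_le (hx m)
    · exact ((hGmem T hT).2 i hi).trans_le (hx _)
  have h1 : μ.real (G ∪ ({T | (xStrategy x).Wins T} \ B)) =
      μ.real G + μ.real ({T | (xStrategy x).Wins T} \ B) := by
    rw [Set.union_comm, measureReal_union hdisj.symm hGmeas, add_comm]
  have h2 := measureReal_mono (μ := μ) hsub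
  have h3 : μ.real {T | (xStrategy x).Wins T} ≤
      μ.real ({T | (xStrategy x).Wins T} \ B) + μ.real B :=
    (measureReal_mono (by rw [Set.sdiff_union_self]; exact Set.subset_union_left)).trans
      (measureReal_union_le _ _)
  change μ.real {T | (xStrategy x).Wins T} + _ ≤ μ.real {T | (cutoffStrategy a).Wins T} + _
  linarith

theorem proposition6 (Z : Finset ℕ) (hZ : ∀ n ∈ Z, 0 < n) :
    ∃ a : ℕ → ℝ, (∀ k, a k ∈ Set.Icc (0 : ℝ) 1) ∧
      BestChoice.StronglyDominatesOn (BestChoice.cutoffStrategy a)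
        (BestChoice.xStrategy (1 / Real.exp 1)) (Z : Set ℕ) := by
  obtain ⟨N, hN⟩ : ∃ N : ℕ, ∀ n ∈ Z, n ≤ N := ⟨Z.sup id, fun n hn => Finset.le_sup (f := id) hn⟩
  set x : ℝ := 1 / Real.exp 1 with hx
  have hx_lower : 0.35 ≤ x := by
    rw [hx, le_div_iff₀ (Real.exp_pos 1)]
    linarith [Real.exp_one_lt_d9]
  have hx_upper : x ≤ 1 := by
    rw [hx, div_le_one (Real.exp_pos 1)]
    exact Real.one_le_exp zero_le_one
  -- All cutoffs will be at least `1/4`, and this choice gives `(M - 1) * (1/4)^N > N`.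
  set M : ℝ := N * 4 ^ N + 2 with hM
  have hM1 : 1 ≤ M := by
    have : (0 : ℝ) ≤ N * 4 ^ N := by positivity
    linarith
  have hMN : 0 < M ^ N := by positivity
  -- Geometric up to index `N`, then constant at `0.1`, so that the cutoffs stay above `0.35 - 0.1`.
  let δ : ℕ → ℝ := fun k => 0.1 / M ^ N * M ^ min k N
  have hδ_pos : ∀ k, 0 < δ k := fun k => by positivity
  have hδ_le : ∀ k, δ k ≤ 0.1 := fun k => by
    have : M ^ min k N ≤ M ^ N := pow_le_pow_right₀ hM1 (min_le_right _ _)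
    calc δ k ≤ 0.1 / M ^ N * M ^ N := mul_le_mul_of_nonneg_left this (by positivity)
      _ = 0.1 := div_mul_cancel₀ _ hMN.ne'
  have hδ_mono : Monotone δ := fun i j hij =>
    mul_le_mul_of_nonneg_left (pow_le_pow_right₀ hM1 (min_le_min_right N hij)) (by positivity)
  have h0 : ∀ k, 0 ≤ x - δ k := fun k => by linarith [hδ_le k]
  have hle : ∀ k, x - δ k ≤ x := fun k => by linarith [hδ_pos k]
  refine ⟨fun k => x - δ k, fun k => ⟨h0 k, (hle k).trans hx_upper⟩, fun n hn => ?_⟩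
  obtain ⟨m, rfl⟩ : ∃ m, n = m + 1 := ⟨n - 1, by have := hZ n hn; omega⟩
  have hmN : m + 1 ≤ N := hN _ hn
  -- For `m = 0` this involves `a 0`, which no strategy consults; it only serves as an auxiliary
  -- level.
  have key := BestChoice.xStrategy_winProb_add_le (a := fun k => x - δ k)
    (fun i j hij => sub_le_sub_left (hδ_mono hij) x) h0 hle hx_upper m
  have hstep : δ (m + 1) = δ m * M := by
    simp only [δ, min_eq_left hmN, min_eq_left (Nat.le_of_succ_le hmN), pow_succ, mul_assoc]
  have hpow : (1 / 4 : ℝ) ^ N ≤ (x - δ (m + 1)) ^ m := calc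
    (1 / 4 : ℝ) ^ N ≤ (1 / 4) ^ m :=
      pow_le_pow_of_le_one (by norm_num) (by norm_num) (Nat.le_of_succ_le hmN)
    _ ≤ _ := pow_le_pow_left₀ (by norm_num) (by linarith [hδ_le (m + 1)]) m
  have hgain : (m + 1 : ℝ) < (M - 1) * (x - δ (m + 1)) ^ m := calc
    (m + 1 : ℝ) ≤ N := by exact_mod_cast hmN
    _ < N + (1 / 4) ^ N := by linarith [show (0 : ℝ) < (1 / 4) ^ N by positivity]
    _ = (M - 1) * (1 / 4) ^ N := by
      have : (4 : ℝ) ^ N * (1 / 4) ^ N = 1 := by rw [← mul_pow]; norm_num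
      rw [hM]
      linear_combination (-(N : ℝ)) * this
    _ ≤ _ := mul_le_mul_of_nonneg_left hpow (by linarith)
  have := mul_lt_mul_of_pos_left hgain (hδ_pos m)
  have e : x - δ m - (x - δ (m + 1)) = δ m * (M - 1) := by rw [hstep]; ring
  have e' : x - (x - δ m) = δ m := by ring
  simp only [e, e'] at key
  linarith
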